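/- For positive integers $n,q$ and $A,B\in \mathrm{M}_n(\mathbb{Z}/q\mathbb{Z})$ let $$K_n(A,B;q)=\sum_{X\in \mathrm{GL}_n(\mathbb{Z}/q\mathbb{Z})} e_q\bigl(\mathrm{tr}(AX+BX^{-1})\bigr),\qquad e_q(x)=e^{2\pi i x/q},$$ let $\gcd(q,A)$ denote the greatest common divisor of $q$ and all entries of $A$, and let $\gcd(q,A,B)$ denote the greatest common divisor of $q$ and all entries of $A$ and $B$. Then for every integer $n\ge 1$ and every real $\varepsilon>0$ there is a constant $C=C(n,\varepsilon)>0$ such that for all integers $q\ge 2$ and all $A,B\in \mathrm{M}_n(\mathbb{Z}/q\mathbb{Z})$: (i) if $\gcd(q,A,B)=1$, then $|K_n(A,B;q)|\le C\,q^{\,n^2-n+1+\varepsilon}$; (ii) if $\ell=\gcd(q,A)$, then $|K_n(A,B;q)|\le C\,q^{\,n^2}(q/\ell)^{-n+1+\varepsilon}$. -/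

import Mathlib

open scoped MatrixGroups

namespace MatrixKloosterman

/-- The additive character `e_q(x) = exp (2 π i x / q)`, evaluated at a residue class modulo `q`
through its representative in `{0, …, q - 1}` (any other integer representative gives the same
value). -/
noncomputable def e (q : ℕ) (x : ZMod q) : ℂ :=
  Complex.exp (2 * Real.pi * Complex.I * (x.val : ℂ) / (q : ℂ))

/-- The matrix Kloosterman sum
`K_n(A, B; q) = ∑_{X ∈ GL_n(ℤ/qℤ)} e_q (tr (A X + B X⁻¹))`. -/
noncomputable def K (n q : ℕ) [NeZero q] (A B : Matrix (Fin n) (Fin n) (ZMod q)) : ℂ :=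
  ∑ X : GL (Fin n) (ZMod q),
    e q (Matrix.trace
      (A * (X : Matrix (Fin n) (Fin n) (ZMod q)) +
        B * ((X⁻¹ : GL (Fin n) (ZMod q)) : Matrix (Fin n) (Fin n) (ZMod q))))

/-- `gcd(q, A)`: the greatest common divisor of `q` and (representatives of) all entries of `A`. -/
def gcdMat {n q : ℕ} (A : Matrix (Fin n) (Fin n) (ZMod q)) : ℕ :=
  Nat.gcd q (Finset.univ.gcd fun ij : Fin n × Fin n => (A ij.1 ij.2).val)

/-- `gcd(q, A, B)`: the greatest common divisor of `q` and all entries of `A` and of `B`. -/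
def gcdMat₂ {n q : ℕ} (A B : Matrix (Fin n) (Fin n) (ZMod q)) : ℕ :=
  Nat.gcd (gcdMat A) (gcdMat B)

end MatrixKloosterman

/-! Replacing `X` by `(1 + e_i wᵀ) X` with `w i = 0` permutes the group, and since `(e_i wᵀ)² = 0`
it changes the phase by a term linear in `w`. Averaging over `w` bounds the sum by the number of `X`
for which column `i` of `X A - B X⁻¹` vanishes off the diagonal (`norm_kloosterman_le_card_filter`).

Put `v = X⁻¹ e_i` and `y = A e_i`: the conditions become `X v = e_i` and `(X y)_j = (B v)_j` for `j
≠ i`, linear in each row of `X` once `v` is fixed. Let `h` be the size of the image of `z ↦ z ⬝ᵥ y`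
on the orthogonal of `v`. Over a cyclic `R` of size `q`, each `v` admits at most `q^(n(n-1)) /
h^(n-1)` matrices (`card_fiber_mul_le`). But `h y` is a multiple of `v`, which leaves at most `q^n /
(ord y / h)^(n-1)` vectors `v` (`card_unimodular_mul_le`). In the product `h` cancels, and summing
over `h ∣ ord y` costs only a divisor count.

For prime power moduli one column of `A` or `B` has the order of the pair `(A, B)`; the Chinese
remainder theorem gives all `q`. Finally `gcd(q, A, B) = 1` forces this order to be `q`, and in
general it is at least `q / gcd(q, A)`. -/

/-! ### The divisor bound -/

open Finset in
/-- The divisor bound. -/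
theorem Nat.exists_card_divisors_le_rpow (ε : ℝ) (hε : 0 < ε) :
    ∃ C : ℝ, 0 < C ∧ ∀ m : ℕ, m ≠ 0 → ((m.divisors.card : ℕ) : ℝ) ≤ C * (m : ℝ) ^ ε := by
  obtain ⟨P, hP⟩ : ∃ P : ℕ, ∀ p : ℕ, P ≤ p → (2 : ℝ) ≤ (p : ℝ) ^ ε := by
    have h := (tendsto_rpow_atTop hε).comp tendsto_natCast_atTop_atTop
    exact Filter.eventually_atTop.1 (h.eventually_ge_atTop 2)
  have hl : 0 < ε * Real.log 2 := mul_pos hε (Real.log_pos one_lt_two)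
  -- Chosen so that `k + 1 ≤ c (1 + k ε log 2)`; Bernoulli's inequality then bounds the right side
  -- by `c (p^ε)^k`. Only primes below `P` lose this factor, hence the constant `c ^ P`.
  set c : ℝ := 1 + 1 / (ε * Real.log 2) with hc
  have hc1 : 1 ≤ c := by rw [hc]; linarith [one_div_pos.2 hl]
  have small (p k : ℕ) (hp : 2 ≤ p) : ((k + 1 : ℕ) : ℝ) ≤ c * ((p : ℝ) ^ ε) ^ k := by
    have h2 : (2 : ℝ) ^ ε ≤ (p : ℝ) ^ ε :=
      Real.rpow_le_rpow zero_le_two (by exact_mod_cast hp) hε.le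
    have h1 : 1 + ε * Real.log 2 ≤ (2 : ℝ) ^ ε := by
      rw [Real.rpow_def_of_pos two_pos]
      linarith [Real.add_one_le_exp (Real.log 2 * ε)]
    have hb : 1 + (k : ℝ) * (ε * Real.log 2) ≤ (1 + ε * Real.log 2) ^ k :=
      one_add_mul_le_pow (by linarith) k
    have h3 : (1 + ε * Real.log 2) ^ k ≤ ((p : ℝ) ^ ε) ^ k := by
      gcongr
      exact h1.trans h2
    have h4 : (k + 1 : ℝ) ≤ c * (1 + (k : ℝ) * (ε * Real.log 2)) := by
      have : c * (1 + (k : ℝ) * (ε * Real.log 2)) =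
          1 + k + (1 / (ε * Real.log 2) + k * (ε * Real.log 2)) := by
        rw [hc]; field_simp; ring
      rw [this]
      have : 0 ≤ 1 / (ε * Real.log 2) + k * (ε * Real.log 2) := by positivity
      linarith
    push_cast
    refine h4.trans ?_
    gcongr
    exact hb.trans h3
  have large (p k : ℕ) (hp : P ≤ p) : ((k + 1 : ℕ) : ℝ) ≤ ((p : ℝ) ^ ε) ^ k := by
    have h1 : (2 : ℝ) ^ k ≤ ((p : ℝ) ^ ε) ^ k := by
      gcongr
      exact hP p hp
    refine le_trans ?_ h1
    exact_mod_cast Nat.lt_two_pow_self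
  refine ⟨c ^ P, by positivity, fun m hm => ?_⟩
  rw [Nat.card_divisors hm, Nat.cast_prod]
  have hm' : (m : ℝ) ^ ε = ∏ p ∈ m.primeFactors, ((p : ℝ) ^ ε) ^ m.factorization p := by
    conv_lhs => rw [← Nat.prod_factorization_pow_eq_self hm]
    rw [Finsupp.prod, Nat.support_factorization, Nat.cast_prod,
      ← Real.finsetProd_rpow _ _ (fun i _ => by positivity)]
    refine prod_congr rfl fun p _ => ?_
    rw [Nat.cast_pow, ← Real.rpow_natCast, ← Real.rpow_natCast, ← Real.rpow_mul (by positivity),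
      ← Real.rpow_mul (by positivity), mul_comm]
  have hcP : ∏ p ∈ m.primeFactors, (if p < P then c else 1) ≤ c ^ P := by
    rw [prod_ite, prod_const_one, mul_one, prod_const]
    refine pow_le_pow_right₀ hc1 ?_
    calc _ ≤ (range P).card := card_le_card fun p hp => by simp at hp ⊢; exact hp.2
      _ = P := card_range P
  calc _ ≤ ∏ p ∈ m.primeFactors, (if p < P then c else 1) * ((p : ℝ) ^ ε) ^ m.factorization p := by
        refine prod_le_prod (fun _ _ => by positivity) fun p hp => ?_
        split_ifs with h
        · exact small p _ (Nat.prime_of_mem_primeFactors hp).two_le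
        · rw [one_mul]; exact large p _ (not_lt.1 h)
    _ ≤ _ := by
        rw [prod_mul_distrib, ← hm']
        gcongr

/-! ### Averaging over transvections -/

namespace MatrixKloosterman

open Matrix Finset

variable {n : ℕ} {R : Type*} [CommRing R] [Fintype R] [DecidableEq R]

/-- The matrix Kloosterman sum over a finite commutative ring attached to an additive character. -/
noncomputable def kloosterman (χ : AddChar R ℂ) (A B : Matrix (Fin n) (Fin n) R) : ℂ :=
  ∑ X : GL (Fin n) R, χ (trace (A * X.1 + B * (X⁻¹).1))

theorem kloosterman_comm (χ : AddChar R ℂ) (A B : Matrix (Fin n) (Fin n) R) :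
    kloosterman χ A B = kloosterman χ B A := by
  refine Fintype.sum_equiv (Equiv.inv _) _ _ fun X => ?_
  simp [add_comm]

/-- The trivial bound, needed in (ii) when the exponent `-n + 1 + ε` is nonnegative. -/
theorem norm_kloosterman_le_card (χ : AddChar R ℂ) (A B : Matrix (Fin n) (Fin n) R) :
    ‖kloosterman χ A B‖ ≤ (Fintype.card R : ℝ) ^ (n ^ 2) := by
  refine (norm_sum_le _ _).trans ?_
  simp only [AddChar.norm_apply, sum_const, nsmul_eq_mul, mul_one, card_univ]
  have h : Fintype.card (GL (Fin n) R) ≤ Fintype.card (Matrix (Fin n) (Fin n) R) :=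
    Fintype.card_le_of_injective _ Units.val_injective
  have h2 : Fintype.card (Matrix (Fin n) (Fin n) R) = Fintype.card R ^ (n ^ 2) := by
    rw [Fintype.card_congr Matrix.of.symm]
    simp [sq, pow_mul]
  exact_mod_cast h.trans_eq h2

theorem sum_dotProduct_eq_ite {χ : AddChar R ℂ} (hχ : χ.IsPrimitive) (m : Fin n → R) :
    ∑ w : Fin n → R, χ (w ⬝ᵥ m) = if m = 0 then (Fintype.card R : ℂ) ^ n else 0 := by
  let ψ : AddChar (Fin n → R) ℂ :=
    { toFun := fun w => χ (w ⬝ᵥ m)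
      map_zero_eq_one' := by simp
      map_add_eq_mul' := fun a b => by rw [add_dotProduct, AddChar.map_add_eq_mul] }
  split_ifs with h
  · simp [h]
  · refine AddChar.sum_eq_zero_iff_ne_zero (ψ := ψ) |>.2 fun h0 => h ?_
    ext j
    by_contra hj
    refine hχ hj ?_
    ext t
    have := DFunLike.congr_fun h0 (Pi.single j t)
    simpa [ψ, mul_comm] using this

/-- The transvection `1 + e_i wᵀ` for a vector `w` with `w i = 0`. -/
def shear (i : Fin n) (w : Fin n → R) (hw : w i = 0) : GL (Fin n) R where
  val := 1 + vecMulVec (Pi.single i 1) w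
  inv := 1 - vecMulVec (Pi.single i 1) w
  val_inv := by
    rw [add_mul, mul_sub, mul_sub, vecMulVec_mul_vecMulVec]
    simp [hw]
  inv_val := by
    rw [sub_mul, mul_add, mul_add, vecMulVec_mul_vecMulVec]
    simp [hw]

/-- Averaging over the transvections `1 + e_i wᵀ` bounds the Kloosterman sum by the number of
solutions of a system of equations. -/
theorem norm_kloosterman_le_card_filter {χ : AddChar R ℂ} (hχ : χ.IsPrimitive)
    (A B : Matrix (Fin n) (Fin n) R) (i : Fin n) :
    ‖kloosterman χ A B‖ ≤ ((univ.filter fun X : GL (Fin n) R =>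
      ∀ j, j ≠ i → (X.1 * A - B * (X⁻¹).1) j i = 0).card : ℝ) := by
  set f : GL (Fin n) R → ℂ := fun X => χ (trace (A * X.1 + B * (X⁻¹).1)) with hf
  set col : GL (Fin n) R → Fin n → R :=
    fun X => Function.update ((X.1 * A - B * (X⁻¹).1).col i) i 0 with hcol
  have key (w : Fin n → R) : kloosterman χ A B = ∑ X, f X * χ (w ⬝ᵥ col X) := by
    -- Zeroing coordinate `i` lets `w` range over the full module; that coordinate is then idle, and
    -- so is entry `i` of `col X`.
    set w' := Function.update w i 0 with hw'
    have hdot (X) : w ⬝ᵥ col X = w' ⬝ᵥ (X.1 * A - B * (X⁻¹).1).col i := by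
      refine Finset.sum_congr rfl fun j _ => ?_
      by_cases hj : j = i
      · subst hj; simp [hcol, hw']
      · simp [hcol, hw', hj]
    refine (Fintype.sum_equiv (Equiv.mulLeft (shear i w' (by simp [hw']))) _ f fun X => rfl).symm.trans
      (Fintype.sum_congr _ _ fun X => ?_)
    rw [hdot, hf, ← AddChar.map_add_eq_mul]
    have e1 : ((shear i w' (by simp [hw']) * X : GL (Fin n) R)).1 =
      (1 + vecMulVec (Pi.single i 1) w') * X.1 := rfl
    have e2 : ((shear i w' (by simp [hw']) * X : GL (Fin n) R)⁻¹).1 =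
      (X⁻¹).1 * (1 - vecMulVec (Pi.single i 1) w') := by
      rw [_root_.mul_inv_rev]; rfl
    have e3 : w' ⬝ᵥ (X.1 * A - B * (X⁻¹).1).col i =
        trace (vecMulVec (Pi.single i 1) w' * (X.1 * A - B * (X⁻¹).1)) := by
      rw [vecMulVec_mul, trace_vecMulVec, single_one_dotProduct]
      rfl
    simp only [Equiv.coe_mulLeft]
    have t1 : trace (A * (vecMulVec (Pi.single i 1) w' * X.1)) =
        trace (vecMulVec (Pi.single i 1) w' * (X.1 * A)) := by
      rw [trace_mul_comm, Matrix.mul_assoc]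
    have t2 : trace (B * ((X⁻¹).1 * vecMulVec (Pi.single i 1) w')) =
        trace (vecMulVec (Pi.single i 1) w' * (B * (X⁻¹).1)) := by
      rw [← Matrix.mul_assoc, trace_mul_comm]
    rw [e1, e2, e3]
    congr 1
    simp only [Matrix.mul_sub, Matrix.mul_add, Matrix.add_mul, Matrix.mul_one, Matrix.one_mul,
      trace_add, trace_sub, t1, t2]
    ring
  have hsum : (Fintype.card R : ℂ) ^ n * kloosterman χ A B =
      ∑ X, f X * if col X = 0 then (Fintype.card R : ℂ) ^ n else 0 := by
    have : ∑ w : Fin n → R, kloosterman χ A B = (Fintype.card R : ℂ) ^ n * kloosterman χ A B := by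
      simp
    rw [← this, Finset.sum_congr rfl fun w _ => key w, sum_comm]
    exact Fintype.sum_congr _ _ fun X => by rw [← mul_sum, sum_dotProduct_eq_ite hχ]
  have hR : (Fintype.card R : ℂ) ^ n ≠ 0 := by
    simp
  have hK : kloosterman χ A B = ∑ X, if col X = 0 then f X else 0 := by
    refine mul_left_cancel₀ hR (hsum.trans ?_)
    rw [mul_sum]
    refine Fintype.sum_congr _ _ fun X => ?_
    split_ifs <;> ring
  rw [hK, ← sum_filter]
  refine (norm_sum_le _ _).trans ?_
  simp only [hf, AddChar.norm_apply, sum_const, nsmul_eq_mul, mul_one]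
  exact_mod_cast card_le_card fun X hX => by
    simp only [mem_filter, mem_univ, true_and, hcol] at hX ⊢
    intro j hj
    simpa [hj] using congrFun hX j

end MatrixKloosterman

/-! ### Counting the solutions -/

namespace MatrixKloosterman

open Matrix Finset

variable {n : ℕ} {R : Type*} [CommRing R]

theorem card_ker_mul_card_range {G H : Type*} [AddGroup G] [AddGroup H] (f : G →+ H) :
    Nat.card f.ker * Nat.card f.range = Nat.card G := by
  rw [← AddSubgroup.index_ker, AddSubgroup.card_mul_index]

/-- The dot product with a fixed vector. -/
def dotHom (v : Fin n → R) : (Fin n → R) →+ R where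
  toFun z := z ⬝ᵥ v
  map_zero' := zero_dotProduct v
  map_add' a b := add_dotProduct a b v

@[simp] theorem dotHom_apply (v z : Fin n → R) : dotHom v z = z ⬝ᵥ v := rfl

/-- The dot product with `y`, restricted to the vectors orthogonal to `v`. -/
def dotHomOrth (v y : Fin n → R) : (dotHom v).ker →+ R :=
  (dotHom y).comp (dotHom v).ker.subtype

theorem dotHomOrth_apply (v y : Fin n → R) (z : (dotHom v).ker) :
    dotHomOrth v y z = z.1 ⬝ᵥ y := rfl

theorem card_ker_dotHom [Finite R] {v : Fin n → R} (hv : ∃ z, z ⬝ᵥ v = 1) :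
    Nat.card (dotHom v).ker = Nat.card R ^ (n - 1) := by
  obtain ⟨z, hz⟩ := hv
  -- For `n = 0` the hypothesis reads `0 = 1`, so the truncated exponent `n - 1` does no harm.
  have hn : n ≠ 0 ∨ Nat.card R = 1 := by
    rcases Nat.eq_zero_or_pos n with rfl | h
    · right
      have h01 : (0 : R) = 1 := by simpa using hz
      have := subsingleton_of_zero_eq_one h01
      exact Nat.card_of_subsingleton 0
    · exact Or.inl h.ne'
  have hr : (dotHom v).range = ⊤ := by
    refine AddMonoidHom.range_eq_top.2 fun t => ⟨t • z, ?_⟩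
    rw [dotHom_apply, smul_dotProduct, hz, smul_eq_mul, mul_one]
  have h := card_ker_mul_card_range (dotHom v)
  rw [hr, AddSubgroup.card_top, Nat.card_fun, Nat.card_fin] at h
  rcases hn with hn | hn
  · refine Nat.eq_of_mul_eq_mul_right (Nat.card_pos (α := R)) (h.trans ?_)
    rw [← pow_succ, Nat.sub_add_cancel (Nat.one_le_iff_ne_zero.2 hn)]
  · rw [hn] at h ⊢
    simpa using h

/-- The size `h` of the image kills it, so `h y` pairs to zero with the orthogonal of `v`. Every `u`
is `(u ⬝ᵥ v) z` plus a vector of that orthogonal, so the pairing with `z` determines `h y`. -/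
theorem card_dotHomOrth_range_nsmul (v y : Fin n → R) [Finite R] {z : Fin n → R}
    (hz : z ⬝ᵥ v = 1) :
    Nat.card (dotHomOrth v y).range • y =
      ((Nat.card (dotHomOrth v y).range • y) ⬝ᵥ z) • v := by
  set h := Nat.card (dotHomOrth v y).range
  have hk (x : Fin n → R) (hx : x ⬝ᵥ v = 0) : (h • y) ⬝ᵥ x = 0 := by
    have : h • (⟨dotHomOrth v y ⟨x, hx⟩, _, rfl⟩ : (dotHomOrth v y).range) = 0 :=
      card_nsmul_eq_zero'
    rw [smul_dotProduct, dotProduct_comm]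
    have h0 : h • dotHomOrth v y ⟨x, hx⟩ = 0 := congrArg Subtype.val this
    exact h0
  refine dotProduct_eq _ _ fun u => ?_
  have := hk (u - (u ⬝ᵥ v) • z) (by rw [sub_dotProduct, smul_dotProduct, hz]; simp)
  rw [dotProduct_sub, dotProduct_smul, sub_eq_zero] at this
  rw [this, smul_dotProduct _ v u, smul_eq_mul, smul_eq_mul, dotProduct_comm u, mul_comm]

/-- The image is cyclic, so its size is the order of some `z ⬝ᵥ y`, which the order of `y` kills. -/
theorem card_dotHomOrth_range_dvd [Finite R] [IsAddCyclic R] (v y : Fin n → R) :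
    Nat.card (dotHomOrth v y).range ∣ addOrderOf y := by
  obtain ⟨⟨g, z, hz⟩, hg⟩ := IsAddCyclic.exists_generator (α := (dotHomOrth v y).range)
  rw [← addOrderOf_eq_card_of_forall_mem_zmultiples hg]
  refine addOrderOf_dvd_of_nsmul_eq_zero (Subtype.ext ?_)
  change addOrderOf y • g = 0
  rw [← hz, dotHomOrth_apply, ← dotProduct_smul, addOrderOf_nsmul_eq_zero, dotProduct_zero]

variable [Fintype R] [DecidableEq R]

/-- Number of invertible matrices with prescribed image of `v` and with all but one entry of the
image of `y` prescribed. -/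
theorem card_fiber_mul_le {v : Fin n → R} (hv : ∃ z, z ⬝ᵥ v = 1) (y b : Fin n → R) (i : Fin n)
    (F : Finset (GL (Fin n) R))
    (hF : ∀ X ∈ F, X.1 *ᵥ v = Pi.single i 1 ∧ ∀ j, j ≠ i → (X.1 *ᵥ y) j = b j) :
    F.card * Nat.card (dotHomOrth v y).range ^ (n - 1) ≤ Nat.card R ^ ((n - 1) * n) := by
  have hn : 1 ≤ n := i.pos
  set s := Nat.card (dotHomOrth v y).ker
  set k := Nat.card (dotHom v).ker with hk
  have hsk : s * Nat.card (dotHomOrth v y).range = k := card_ker_mul_card_range _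
  let T : Fin n → Finset (Fin n → R) := fun j =>
    univ.filter fun z => z ⬝ᵥ v = (Pi.single i 1 : Fin n → R) j ∧ (j ≠ i → z ⬝ᵥ y = b j)
  have hTi : (T i).card ≤ k := by
    rcases (T i).eq_empty_or_nonempty with h | ⟨z₁, h₁⟩
    · simp [h]
    rw [← Fintype.card_coe, ← Nat.card_eq_fintype_card, hk]
    simp only [T, mem_filter, mem_univ, true_and] at h₁
    refine Nat.card_le_card_of_injective
      (fun z : T i => (⟨z.1 - z₁, ?_⟩ : (dotHom v).ker)) fun z z' h => ?_
    · have hz := z.2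
      simp only [T, mem_filter, mem_univ, true_and] at hz
      rw [AddMonoidHom.mem_ker, dotHom_apply, sub_dotProduct, hz.1, h₁.1, sub_self]
    · exact Subtype.ext (sub_left_injective (congrArg Subtype.val h))
  have hTj (j : Fin n) (hj : j ≠ i) : (T j).card ≤ s := by
    rcases (T j).eq_empty_or_nonempty with h | ⟨z₁, h₁⟩
    · simp [h]
    rw [← Fintype.card_coe, ← Nat.card_eq_fintype_card]
    simp only [T, mem_filter, mem_univ, true_and] at h₁
    have hz (z : T j) : z.1 ⬝ᵥ v = z₁ ⬝ᵥ v ∧ z.1 ⬝ᵥ y = z₁ ⬝ᵥ y := by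
      have hz := z.2
      simp only [T, mem_filter, mem_univ, true_and] at hz
      exact ⟨hz.1.trans h₁.1.symm, (hz.2 hj).trans (h₁.2 hj).symm⟩
    refine Nat.card_le_card_of_injective
      (fun z : T j =>
        (⟨⟨z.1 - z₁, ?_⟩, ?_⟩ : (dotHomOrth v y).ker)) fun z z' h => ?_
    · rw [AddMonoidHom.mem_ker, dotHom_apply, sub_dotProduct, (hz z).1, sub_self]
    · rw [AddMonoidHom.mem_ker, dotHomOrth_apply, sub_dotProduct, (hz z).2, sub_self]
    · exact Subtype.ext (sub_left_injective (congrArg (fun x => x.1.1) h))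
  have hFT : F.card ≤ k * s ^ (n - 1) := by
    calc F.card ≤ (Fintype.piFinset T).card := by
          refine card_le_card_of_injOn (fun X j k => X.1 j k) (fun X hX => ?_) fun X _ X' _ h => ?_
          · rw [mem_coe, Fintype.mem_piFinset]
            intro j
            simp only [T, mem_filter, mem_univ, true_and]
            exact ⟨congrFun (hF X hX).1 j, (hF X hX).2 j⟩
          · exact Units.ext (Matrix.ext fun j k => congrFun (congrFun h j) k)
      _ = (T i).card * ∏ j ∈ univ.erase i, (T j).card := by
          rw [Fintype.card_piFinset, mul_prod_erase univ (fun j => (T j).card) (mem_univ i)]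
      _ ≤ k * s ^ (n - 1) := by
          refine Nat.mul_le_mul hTi ?_
          refine (prod_le_pow_card _ _ s fun j hj => hTj j (ne_of_mem_erase hj)).trans_eq ?_
          simp
  calc _ ≤ k * s ^ (n - 1) * Nat.card (dotHomOrth v y).range ^ (n - 1) :=
        Nat.mul_le_mul_right _ hFT
    _ = k ^ n := by
        rw [mul_assoc, ← mul_pow, hsk, ← pow_succ', Nat.sub_add_cancel hn]
    _ = _ := by rw [hk, card_ker_dotHom hv, pow_mul]

/-- Number of unimodular vectors `v` such that `h y` is a multiple of `v`. -/
theorem card_unimodular_mul_le [IsAddCyclic R] (hn : 1 ≤ n) (y : Fin n → R) {h : ℕ}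
    (hh : h ∣ addOrderOf y) (V : Finset (Fin n → R))
    (hV : ∀ v ∈ V, (∃ z, z ⬝ᵥ v = 1) ∧ ∃ c : R, h • y = c • v) :
    V.card * (addOrderOf y / h) ^ (n - 1) ≤ Nat.card R ^ n := by
  have hr : 0 < addOrderOf y := addOrderOf_pos y
  have hh0 : h ≠ 0 := fun h0 => hr.ne' (Nat.eq_zero_of_zero_dvd (h0 ▸ hh))
  set m := addOrderOf y / h with hm
  have hm0 : 0 < m := Nat.div_pos (Nat.le_of_dvd hr hh) (Nat.pos_of_ne_zero hh0)
  have hy : addOrderOf (h • y) = m := addOrderOf_nsmul_of_dvd hh0 hh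
  let W : R → Finset (Fin n → R) := fun c => univ.filter fun v => c • v = h • y
  -- Scaling a unimodular `v` is injective, so `c` has the order `m` of `h • y`.
  have hVW : V ⊆ (univ.filter fun c : R => addOrderOf c = m).biUnion W := by
    intro v hv
    obtain ⟨⟨z, hz⟩, c, hc⟩ := hV v hv
    simp only [mem_biUnion, mem_filter, mem_univ, true_and, W]
    refine ⟨c, ?_, hc.symm⟩
    rw [← hy, hc]
    refine (addOrderOf_injective
      ({ toFun := fun c => c • v, map_zero' := zero_smul _ _,
         map_add' := fun a b => add_smul a b v } : R →+ (Fin n → R)) (fun a b hab => ?_) c).symm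
    have := congrArg (fun u => z ⬝ᵥ u) hab
    simpa [dotProduct_smul, hz] using this
  -- A nonempty `W c` is a coset of `n` copies of the annihilator of `c`, which has size at most
  -- `|R| / m` because `c R` contains the multiples of `c`.
  have hW (c : R) (hc : addOrderOf c = m) : (W c).card * m ^ n ≤ Nat.card R ^ n := by
    have hker : Nat.card (AddMonoidHom.mulLeft c).ker * m ≤ Nat.card R := by
      rw [← card_ker_mul_card_range (AddMonoidHom.mulLeft c), ← hc, ← Nat.card_zmultiples]
      refine Nat.mul_le_mul_left _ (AddSubgroup.card_le_of_le ?_)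
      rw [AddSubgroup.zmultiples_le]
      exact ⟨1, by simp⟩
    refine le_trans ?_ (Nat.pow_le_pow_left hker n)
    rw [mul_pow]
    refine Nat.mul_le_mul_right _ ?_
    rcases (W c).eq_empty_or_nonempty with h0 | ⟨v₁, h₁⟩
    · simp [h0]
    have : Nat.card (Fin n → (AddMonoidHom.mulLeft c).ker) =
        Nat.card (AddMonoidHom.mulLeft c).ker ^ n := by simp
    rw [← this, ← Fintype.card_coe, ← Nat.card_eq_fintype_card]
    simp only [W, mem_filter, mem_univ, true_and] at h₁
    refine Nat.card_le_card_of_injective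
      (fun v : W c => fun j =>
        (⟨v.1 j - v₁ j, ?_⟩ : (AddMonoidHom.mulLeft c).ker)) fun v v' hvv => ?_
    · have hv := v.2
      simp only [W, mem_filter, mem_univ, true_and] at hv
      have := congrFun (hv.trans h₁.symm) j
      simp only [Pi.smul_apply, smul_eq_mul] at this
      rw [AddMonoidHom.mem_ker, AddMonoidHom.coe_mulLeft, mul_sub, this, sub_self]
    · refine Subtype.ext (funext fun j => ?_)
      exact sub_left_injective (congrArg Subtype.val (congrFun hvv j))
  have hcard : (univ.filter fun c : R => addOrderOf c = m).card ≤ m := by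
    refine le_trans (card_le_card fun c hc => ?_) (IsAddCyclic.card_nsmul_eq_zero_le (α := R) hm0)
    simp only [mem_filter, mem_univ, true_and] at hc ⊢
    rw [← hc, addOrderOf_nsmul_eq_zero]
  have hV' : V.card * m ^ n ≤ m * Nat.card R ^ n := by
    calc V.card * m ^ n
        ≤ (∑ c ∈ univ.filter fun c : R => addOrderOf c = m, (W c).card) * m ^ n :=
          Nat.mul_le_mul_right _ ((card_le_card hVW).trans card_biUnion_le)
      _ = ∑ c ∈ univ.filter fun c : R => addOrderOf c = m, (W c).card * m ^ n := sum_mul _ _ _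
      _ ≤ ∑ c ∈ univ.filter fun c : R => addOrderOf c = m, Nat.card R ^ n :=
          sum_le_sum fun c hc => hW c (mem_filter.1 hc).2
      _ ≤ m * Nat.card R ^ n := by
          rw [sum_const, smul_eq_mul]
          exact Nat.mul_le_mul_right _ hcard
  refine Nat.le_of_mul_le_mul_left ?_ hm0
  calc m * (V.card * m ^ (n - 1)) = V.card * m ^ n := by
        rw [mul_left_comm, ← pow_succ', Nat.sub_add_cancel hn]
    _ ≤ _ := hV'

/-- Number of solutions of the system of equations obtained by averaging. -/
theorem card_filter_mul_le [IsAddCyclic R] (A B : Matrix (Fin n) (Fin n) R) (i : Fin n) :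
    (univ.filter fun X : GL (Fin n) R => ∀ j, j ≠ i → (X.1 * A - B * (X⁻¹).1) j i = 0).card *
      addOrderOf (A.col i) ^ (n - 1) ≤
    (addOrderOf (A.col i)).divisors.card * Nat.card R ^ (n ^ 2) := by
  have hn : 1 ≤ n := i.pos
  set S := univ.filter fun X : GL (Fin n) R => ∀ j, j ≠ i → (X.1 * A - B * (X⁻¹).1) j i = 0
    with hS
  set y := A.col i with hy
  let vec : GL (Fin n) R → Fin n → R := fun X => (X⁻¹).1.col i
  have hvec (X : GL (Fin n) R) : X.1 *ᵥ vec X = Pi.single i 1 := by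
    have h1 : X.1 * (X⁻¹).1 = 1 := by rw [← Units.val_mul, mul_inv_cancel, Units.val_one]
    ext j
    have h3 := congrFun (congrFun h1 j) i
    rw [Matrix.one_apply] at h3
    rw [Pi.single_apply, ← h3]
    rfl
  have huni (X : GL (Fin n) R) : ∃ z, z ⬝ᵥ vec X = 1 :=
    ⟨X.1 i, by simpa [mulVec] using congrFun (hvec X) i⟩
  let ord : GL (Fin n) R → ℕ := fun X => Nat.card (dotHomOrth (vec X) y).range
  have hord (X) (_ : X ∈ S) : ord X ∈ (addOrderOf y).divisors :=
    Nat.mem_divisors.2 ⟨card_dotHomOrth_range_dvd _ _, (addOrderOf_pos y).ne'⟩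
  rw [card_eq_sum_card_fiberwise hord, sum_mul, ← smul_eq_mul (α := ℕ), ← sum_const]
  refine sum_le_sum fun h hh => ?_
  have hdvd := Nat.dvd_of_mem_divisors hh
  set Sh := S.filter fun X => ord X = h
  set V := Sh.image vec
  have hVcard : V.card * (addOrderOf y / h) ^ (n - 1) ≤ Nat.card R ^ n := by
    refine card_unimodular_mul_le hn y hdvd V fun v hv => ?_
    obtain ⟨X, hX, rfl⟩ := mem_image.1 hv
    obtain ⟨z, hz⟩ := huni X
    have := card_dotHomOrth_range_nsmul (vec X) y hz
    rw [show Nat.card (dotHomOrth (vec X) y).range = h from (mem_filter.1 hX).2] at this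
    exact ⟨⟨z, hz⟩, _, this⟩
  have hSh : Sh.card * h ^ (n - 1) ≤ V.card * Nat.card R ^ ((n - 1) * n) := by
    rw [card_eq_sum_card_image vec Sh, sum_mul, ← smul_eq_mul (α := ℕ), ← sum_const]
    refine sum_le_sum fun v hv => ?_
    obtain ⟨X, hX, rfl⟩ := mem_image.1 hv
    have := card_fiber_mul_le (huni X) y (B *ᵥ vec X) i (Sh.filter fun X' => vec X' = vec X)
      fun X' hX' => ?_
    · rwa [show Nat.card (dotHomOrth (vec X) y).range = h from (mem_filter.1 hX).2] at this
    · obtain ⟨hX', hXX⟩ := mem_filter.1 hX'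
      refine ⟨hXX ▸ hvec X', fun j hj => ?_⟩
      have := (mem_filter.1 (mem_filter.1 hX').1).2 j hj
      rw [Matrix.sub_apply, sub_eq_zero] at this
      rw [← hXX]
      exact this
  calc Sh.card * addOrderOf y ^ (n - 1)
      = Sh.card * h ^ (n - 1) * (addOrderOf y / h) ^ (n - 1) := by
        rw [mul_assoc, ← mul_pow, Nat.mul_div_cancel' hdvd]
    _ ≤ V.card * Nat.card R ^ ((n - 1) * n) * (addOrderOf y / h) ^ (n - 1) :=
        Nat.mul_le_mul_right _ hSh
    _ = V.card * (addOrderOf y / h) ^ (n - 1) * Nat.card R ^ ((n - 1) * n) := by ring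
    _ ≤ Nat.card R ^ n * Nat.card R ^ ((n - 1) * n) := Nat.mul_le_mul_right _ hVcard
    _ = Nat.card R ^ (n ^ 2) := by
        rw [← pow_add]
        congr 1
        obtain ⟨k, rfl⟩ := Nat.exists_eq_add_of_le' hn
        simp only [Nat.add_sub_cancel]
        ring

/-- The bound for matrix Kloosterman sums in terms of the additive order of one column. -/
theorem norm_kloosterman_mul_le_of_col [IsAddCyclic R] {χ : AddChar R ℂ} (hχ : χ.IsPrimitive)
    (A B : Matrix (Fin n) (Fin n) R) (i : Fin n) :
    ‖kloosterman χ A B‖ * (addOrderOf (A.col i) : ℝ) ^ (n - 1) ≤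
      ((addOrderOf (A.col i)).divisors.card : ℝ) * (Nat.card R : ℝ) ^ (n ^ 2) := by
  refine (mul_le_mul_of_nonneg_right (norm_kloosterman_le_card_filter hχ A B i)
    (by positivity)).trans ?_
  exact_mod_cast card_filter_mul_le A B i

end MatrixKloosterman

/-! ### Chinese remainder theorem and prime powers -/

namespace MatrixKloosterman

open Matrix Finset

variable {n : ℕ}

section Ring

variable {R S : Type*} [CommRing R] [CommRing S]

/-- Entrywise pairing of matrices. -/
def prodMatrix : Matrix (Fin n) (Fin n) R × Matrix (Fin n) (Fin n) S ≃+*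
    Matrix (Fin n) (Fin n) (R × S) where
  toFun A := of fun i j => (A.1 i j, A.2 i j)
  invFun A := (A.map Prod.fst, A.map Prod.snd)
  left_inv _ := rfl
  right_inv _ := rfl
  map_add' _ _ := rfl
  map_mul' A B := by
    ext i j
    · simp [Matrix.mul_apply, Prod.fst_sum]
    · simp [Matrix.mul_apply, Prod.snd_sum]

theorem trace_prodMatrix (M : Matrix (Fin n) (Fin n) R × Matrix (Fin n) (Fin n) S) :
    trace (prodMatrix M) = (trace M.1, trace M.2) := by
  ext
  · exact Prod.fst_sum
  · exact Prod.snd_sum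

/-- Restricting to a factor may change a standard character into another primitive one, which is why
the bounds treat all primitive characters. -/
theorem isPrimitive_comp_inl {χ : AddChar (R × S) ℂ} (hχ : χ.IsPrimitive) :
    (χ.compAddMonoidHom (AddMonoidHom.inl R S)).IsPrimitive := by
  intro a ha h
  refine hχ (a := (a, 0)) (by simpa using ha) ?_
  ext x
  have hx : ((a, 0) : R × S) * x = (a * x.1, 0) := Prod.ext rfl (zero_mul x.2)
  simpa [hx] using DFunLike.congr_fun h x.1

theorem isPrimitive_comp_inr {χ : AddChar (R × S) ℂ} (hχ : χ.IsPrimitive) :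
    (χ.compAddMonoidHom (AddMonoidHom.inr R S)).IsPrimitive := by
  intro a ha h
  refine hχ (a := (0, a)) (by simpa using ha) ?_
  ext x
  have hx : ((0, a) : R × S) * x = (0, a * x.2) := Prod.ext (zero_mul x.1) rfl
  simpa [hx] using DFunLike.congr_fun h x.2

theorem isPrimitive_comp_equiv (f : R ≃+* S) {χ : AddChar S ℂ} (hχ : χ.IsPrimitive) :
    (χ.compAddMonoidHom (f : R →+* S).toAddMonoidHom).IsPrimitive := by
  intro a ha h
  refine hχ (a := f a) (by simpa using ha) ?_
  ext x
  simpa using DFunLike.congr_fun h (f.symm x)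

theorem addOrderOf_dvd_card_pair [Finite R] (A B : Matrix (Fin n) (Fin n) R) :
    addOrderOf (A, B) ∣ Nat.card R := by
  refine addOrderOf_dvd_of_nsmul_eq_zero ?_
  ext i j
  · exact card_nsmul_eq_zero' (x := A i j)
  · exact card_nsmul_eq_zero' (x := B i j)

variable [Fintype R] [DecidableEq R] [Fintype S] [DecidableEq S]

theorem kloosterman_map_equiv (f : R ≃+* S) (χ : AddChar S ℂ) (A B : Matrix (Fin n) (Fin n) R) :
    kloosterman χ (A.map f) (B.map f) =
      kloosterman (χ.compAddMonoidHom (f : R →+* S).toAddMonoidHom) A B := by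
  refine (Fintype.sum_equiv (Units.mapEquiv f.mapMatrix.toMulEquiv).toEquiv _ _ fun X => ?_).symm
  have h1 : ((Units.mapEquiv f.mapMatrix.toMulEquiv).toEquiv X).1 = X.1.map f := rfl
  have h2 : (((Units.mapEquiv f.mapMatrix.toMulEquiv).toEquiv X)⁻¹).1 = (X⁻¹).1.map f := rfl
  rw [h1, h2, ← Matrix.map_mul, ← Matrix.map_mul, ← Matrix.map_add _ (map_add f)]
  change χ (f (trace _)) = _
  exact congrArg χ (AddMonoidHom.map_trace (f : R →+* S).toAddMonoidHom _)

theorem kloosterman_prod (χ : AddChar (R × S) ℂ)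
    (A B : Matrix (Fin n) (Fin n) R × Matrix (Fin n) (Fin n) S) :
    kloosterman χ (prodMatrix A) (prodMatrix B) =
      kloosterman (χ.compAddMonoidHom (AddMonoidHom.inl R S)) A.1 B.1 *
        kloosterman (χ.compAddMonoidHom (AddMonoidHom.inr R S)) A.2 B.2 := by
  rw [kloosterman, kloosterman, kloosterman, sum_mul_sum, ← Fintype.sum_prod_type']
  refine (Fintype.sum_equiv ((MulEquiv.prodUnits.symm.trans
    (Units.mapEquiv (prodMatrix (n := n) (R := R) (S := S)).toMulEquiv)).toEquiv) _ _
    fun X => ?_).symm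
  have h1 : (((MulEquiv.prodUnits.symm.trans
    (Units.mapEquiv (prodMatrix (n := n) (R := R) (S := S)).toMulEquiv)).toEquiv) X).1 =
      prodMatrix (X.1.1, X.2.1) := rfl
  have h2 : ((((MulEquiv.prodUnits.symm.trans
    (Units.mapEquiv (prodMatrix (n := n) (R := R) (S := S)).toMulEquiv)).toEquiv) X)⁻¹).1 =
      prodMatrix ((X.1⁻¹).1, (X.2⁻¹).1) := rfl
  rw [h1, h2, ← map_mul, ← map_mul, ← map_add, trace_prodMatrix, AddChar.compAddMonoidHom_apply,
    AddChar.compAddMonoidHom_apply, ← AddChar.map_add_eq_mul]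
  simp

variable (n R) in
/-- The bound for all matrix Kloosterman sums over `R` in terms of the additive order of the pair
of matrices. -/
def OrderBound : Prop :=
  ∀ χ : AddChar R ℂ, χ.IsPrimitive → ∀ A B : Matrix (Fin n) (Fin n) R,
    ‖kloosterman χ A B‖ * (addOrderOf (A, B) : ℝ) ^ (n - 1) ≤
      ((addOrderOf (A, B)).divisors.card : ℝ) * (Nat.card R : ℝ) ^ (n ^ 2)

theorem OrderBound.of_equiv (f : R ≃+* S) (h : OrderBound n R) : OrderBound n S := by
  intro χ hχ A B
  have := h _ (isPrimitive_comp_equiv f hχ) (A.map f.symm) (B.map f.symm)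
  rw [← kloosterman_map_equiv, Nat.card_congr f.toEquiv] at this
  have e : ∀ M : Matrix (Fin n) (Fin n) S, (M.map f.symm).map f = M := fun M => by ext; simp
  have ho : addOrderOf (A.map f.symm, B.map f.symm) = addOrderOf (A, B) := by
    have := addOrderOf_injective (AddMonoidHom.prodMap
      (f.symm.mapMatrix : _ ≃+* Matrix (Fin n) (Fin n) R).toAddEquiv.toAddMonoidHom
      (f.symm.mapMatrix : _ ≃+* Matrix (Fin n) (Fin n) R).toAddEquiv.toAddMonoidHom)
      (Function.Injective.prodMap (f.symm.mapMatrix).injective (f.symm.mapMatrix).injective) (A, B)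
    exact this
  rwa [e, e, ho] at this

/-- Sums, orders and divisor counts all multiply across coprime factors. As the bound carries no
constant, nothing accumulates with the number of primes. -/
theorem OrderBound.prod (hRS : (Nat.card R).Coprime (Nat.card S)) (hR : OrderBound n R)
    (hS : OrderBound n S) : OrderBound n (R × S) := by
  intro χ hχ A B
  obtain ⟨A, rfl⟩ := prodMatrix.surjective A
  obtain ⟨B, rfl⟩ := prodMatrix.surjective B
  have h1 := hR _ (isPrimitive_comp_inl hχ) A.1 B.1
  have h2 := hS _ (isPrimitive_comp_inr hχ) A.2 B.2
  have hcop : (addOrderOf (A.1, B.1)).Coprime (addOrderOf (A.2, B.2)) :=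
    Nat.Coprime.of_dvd (addOrderOf_dvd_card_pair _ _) (addOrderOf_dvd_card_pair _ _) hRS
  have ho : addOrderOf (prodMatrix A, prodMatrix B) =
      addOrderOf (A.1, B.1) * addOrderOf (A.2, B.2) := by
    have hi (M : Matrix (Fin n) (Fin n) R × Matrix (Fin n) (Fin n) S) :
        addOrderOf (prodMatrix M) = addOrderOf M :=
      addOrderOf_injective (prodMatrix (n := n) (R := R) (S := S)).toAddEquiv.toAddMonoidHom
        prodMatrix.injective M
    rw [← hcop.lcm_eq_mul, Prod.addOrderOf_mk, hi, hi, Prod.addOrderOf, Prod.addOrderOf,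
      Prod.addOrderOf_mk, Prod.addOrderOf_mk]
    rw [Nat.lcm_assoc, Nat.lcm_assoc, ← Nat.lcm_assoc (addOrderOf A.2),
      Nat.lcm_comm (addOrderOf A.2), Nat.lcm_assoc]
  rw [kloosterman_prod, ho, norm_mul, hcop.card_divisors_mul, Nat.card_prod]
  push_cast
  rw [mul_pow, mul_pow, mul_mul_mul_comm, mul_mul_mul_comm (_ : ℝ) _ (_ ^ (n ^ 2))]
  exact mul_le_mul h1 h2 (by positivity) (by positivity)

end Ring

theorem addOrderOf_dvd_zmod (q : ℕ) (A : Matrix (Fin n) (Fin n) (ZMod q)) : addOrderOf A ∣ q := by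
  refine addOrderOf_dvd_of_nsmul_eq_zero ?_
  ext i j
  simp

/-- Orders are powers of `p`, hence totally ordered by divisibility: some column attains the order
of its matrix, and one of `A`, `B` attains that of the pair. The symmetry in `A` and `B` covers both
cases. -/
theorem orderBound_prime_pow (hn : 1 ≤ n) (p k : ℕ) (hp : p.Prime) [NeZero (p ^ k)] :
    OrderBound n (ZMod (p ^ k)) := by
  have main (χ : AddChar (ZMod (p ^ k)) ℂ) (hχ : χ.IsPrimitive)
      (A B : Matrix (Fin n) (Fin n) (ZMod (p ^ k))) :
      ‖kloosterman χ A B‖ * (addOrderOf A : ℝ) ^ (n - 1) ≤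
        ((addOrderOf A).divisors.card : ℝ) * (Nat.card (ZMod (p ^ k)) : ℝ) ^ (n ^ 2) := by
    obtain ⟨i, hi⟩ : ∃ i, addOrderOf (A.col i) = addOrderOf A := by
      obtain ⟨j, -, hj⟩ := (Nat.dvd_prime_pow hp).1 (addOrderOf_dvd_zmod _ A)
      have hcol (i : Fin n) (m : ℕ) : m • A.col i = (m • A).col i := rfl
      rcases j with _ | j
      · refine ⟨⟨0, hn⟩, ?_⟩
        have hA : A = 0 := by simpa using hj
        rw [hA]
        simp
        rfl
      · have hne : p ^ j • A ≠ 0 := fun h0 => by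
          have := addOrderOf_dvd_of_nsmul_eq_zero h0
          rw [hj, Nat.pow_dvd_pow_iff_le_right hp.one_lt] at this
          omega
        obtain ⟨i, hi⟩ : ∃ i, (p ^ j • A).col i ≠ 0 := by
          by_contra! hall
          exact hne (Matrix.ext fun a b => congrFun (hall b) a)
        refine ⟨i, ?_⟩
        have : Fact p.Prime := ⟨hp⟩
        rw [hj]
        refine addOrderOf_eq_prime_pow (by rwa [hcol]) ?_
        rw [hcol, ← hj, addOrderOf_nsmul_eq_zero]
        rfl
    rw [← hi]
    exact norm_kloosterman_mul_le_of_col hχ A B i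
  intro χ hχ A B
  obtain ⟨a, -, ha⟩ := (Nat.dvd_prime_pow hp).1 (addOrderOf_dvd_zmod _ A)
  obtain ⟨b, -, hb⟩ := (Nat.dvd_prime_pow hp).1 (addOrderOf_dvd_zmod _ B)
  rw [Prod.addOrderOf_mk]
  rcases le_total a b with h | h
  · rw [Nat.lcm_eq_right (by rw [ha, hb]; exact pow_dvd_pow p h), kloosterman_comm]
    exact main χ hχ B A
  · rw [Nat.lcm_eq_left (by rw [ha, hb]; exact pow_dvd_pow p h)]
    exact main χ hχ A B

theorem orderBound_zmod (hn : 1 ≤ n) (q : ℕ) [NeZero q] : OrderBound n (ZMod q) := by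
  revert ‹NeZero q›
  induction q using Nat.recOnPosPrimePosCoprime with
  | prime_pow p k hp _ =>
    intro _
    exact orderBound_prime_pow hn p k hp
  | zero =>
    intro h
    exact absurd rfl h.out
  | one =>
    intro _
    have := orderBound_prime_pow hn 2 0 Nat.prime_two
    exact this
  | coprime a b ha hb hab iha ihb =>
    intro _
    have : NeZero a := ⟨by omega⟩
    have : NeZero b := ⟨by omega⟩
    refine OrderBound.of_equiv (ZMod.chineseRemainder hab).symm (OrderBound.prod ?_ iha ihb)
    simpa using hab

/-! ### From orders back to greatest common divisors -/

theorem e_eq_stdAddChar (q : ℕ) [NeZero q] (x : ZMod q) : e q x = ZMod.stdAddChar x := by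
  rw [e, ZMod.stdAddChar_apply, ZMod.toCircle_apply]

theorem K_eq_kloosterman (q : ℕ) [NeZero q] (A B : Matrix (Fin n) (Fin n) (ZMod q)) :
    K n q A B = kloosterman ZMod.stdAddChar A B :=
  Finset.sum_congr (by congr) fun _ _ => e_eq_stdAddChar q _

theorem div_dvd_gcdMat {q r : ℕ} [NeZero q] {A : Matrix (Fin n) (Fin n) (ZMod q)} (hr : r ∣ q)
    (hA : r • A = 0) : q / r ∣ gcdMat A := by
  have hr0 : 0 < r := Nat.pos_of_dvd_of_pos hr (NeZero.pos q)
  refine Nat.dvd_gcd (Nat.div_dvd_of_dvd hr) (Finset.dvd_gcd fun ij _ => ?_)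
  refine Nat.dvd_of_mul_dvd_mul_left hr0 ?_
  rw [Nat.mul_div_cancel' hr, ← ZMod.natCast_eq_zero_iff, Nat.cast_mul, ZMod.natCast_zmod_val]
  have := congrFun (congrFun hA ij.1) ij.2
  rwa [Matrix.smul_apply, nsmul_eq_mul] at this

/-- The bound in terms of the order of the pair of matrices, with the number of divisors estimated. -/
theorem exists_norm_K_le (hn : 1 ≤ n) {ε : ℝ} (hε : 0 < ε) :
    ∃ C : ℝ, 0 < C ∧ ∀ (q : ℕ) [NeZero q] (A B : Matrix (Fin n) (Fin n) (ZMod q)),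
      ‖K n q A B‖ ≤
        C * ((q : ℝ) ^ (n ^ 2) * (addOrderOf (A, B) : ℝ) ^ (-(n : ℝ) + 1 + ε)) := by
  obtain ⟨C, hC, hd⟩ := Nat.exists_card_divisors_le_rpow ε hε
  refine ⟨C, hC, fun q _ A B => ?_⟩
  have h := orderBound_zmod hn q ZMod.stdAddChar (ZMod.isPrimitive_stdAddChar q) A B
  rw [← K_eq_kloosterman, Nat.card_zmod] at h
  set r := addOrderOf (A, B)
  have hr : 0 < r := addOrderOf_pos _
  have hr' : (0 : ℝ) < r := Nat.cast_pos.2 hr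
  have hpow : (r : ℝ) ^ (-(n : ℝ) + 1 + ε) * (r : ℝ) ^ (n - 1) = (r : ℝ) ^ ε := by
    rw [← Real.rpow_natCast, ← Real.rpow_add hr', Nat.cast_sub hn]
    congr 1
    push_cast
    ring
  refine le_of_mul_le_mul_right ?_ (pow_pos hr' (n - 1))
  calc _ ≤ _ := h
    _ ≤ C * (r : ℝ) ^ ε * (q : ℝ) ^ (n ^ 2) := by
        gcongr
        exact hd r hr.ne'
    _ = _ := by
        rw [← hpow]
        ring

end MatrixKloosterman

open MatrixKloosterman in
theorem theorem5p11 (n : ℕ) (hn : 1 ≤ n) (ε : ℝ) (hε : 0 < ε) :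
    (∃ C : ℝ, 0 < C ∧ ∀ (q : ℕ) [NeZero q], 2 ≤ q →
      ∀ A B : Matrix (Fin n) (Fin n) (ZMod q), MatrixKloosterman.gcdMat₂ A B = 1 →
        ‖MatrixKloosterman.K n q A B‖ ≤ C * (q : ℝ) ^ ((n : ℝ) ^ 2 - (n : ℝ) + 1 + ε)) ∧
    (∃ C : ℝ, 0 < C ∧ ∀ (q : ℕ) [NeZero q], 2 ≤ q →
      ∀ (A B : Matrix (Fin n) (Fin n) (ZMod q)) (ℓ : ℕ), ℓ = MatrixKloosterman.gcdMat A →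
        ‖MatrixKloosterman.K n q A B‖ ≤
          C * ((q : ℝ) ^ (n ^ 2) * ((q : ℝ) / (ℓ : ℝ)) ^ (-(n : ℝ) + 1 + ε))) := by
  have hord (q : ℕ) [NeZero q] (A B : Matrix (Fin n) (Fin n) (ZMod q)) :
      addOrderOf (A, B) ∣ q ∧ addOrderOf (A, B) • A = 0 ∧ addOrderOf (A, B) • B = 0 := by
    refine ⟨?_, congrArg Prod.fst (addOrderOf_nsmul_eq_zero (A, B)),
      congrArg Prod.snd (addOrderOf_nsmul_eq_zero (A, B))⟩
    rw [Prod.addOrderOf_mk]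
    exact Nat.lcm_dvd (addOrderOf_dvd_zmod q A) (addOrderOf_dvd_zmod q B)
  obtain ⟨C, hC, hK⟩ := exists_norm_K_le hn hε
  refine ⟨⟨C, hC, fun q _ _ A B hAB => ?_⟩, ⟨C + 1, by positivity, fun q _ hq A B ℓ hℓ => ?_⟩⟩
  · obtain ⟨hr, hA, hB⟩ := hord q A B
    have hdvd : q / addOrderOf (A, B) ∣ 1 := by
      rw [← hAB]
      exact Nat.dvd_gcd (div_dvd_gcdMat hr hA) (div_dvd_gcdMat hr hB)
    have hrq : addOrderOf (A, B) = q := by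
      simpa [Nat.dvd_one.1 hdvd] using Nat.div_mul_cancel hr
    have := hK q A B
    rw [hrq, ← Real.rpow_natCast, ← Real.rpow_add (Nat.cast_pos.2 (NeZero.pos q))] at this
    refine this.trans_eq ?_
    congr 2
    push_cast
    ring
  · obtain ⟨hr, hA, -⟩ := hord q A B
    have hq0 : (0 : ℝ) < q := Nat.cast_pos.2 (NeZero.pos q)
    have hℓq : ℓ ∣ q := hℓ ▸ Nat.gcd_dvd_left _ _
    have hℓ0 : 0 < ℓ := Nat.pos_of_dvd_of_pos hℓq (NeZero.pos q)
    have hone : 1 ≤ (q : ℝ) / ℓ := by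
      rw [one_le_div (by exact_mod_cast hℓ0)]
      exact_mod_cast Nat.le_of_dvd (NeZero.pos q) hℓq
    -- If the exponent is nonnegative, the power of `q / ℓ` is at least `1` and the trivial bound
    -- suffices; this is why the constant is `C + 1`. Otherwise the power is decreasing and `q / ℓ`
    -- may replace the larger order.
    rcases le_total 0 (-(n : ℝ) + 1 + ε) with hs | hs
    · have h1 := Real.one_le_rpow hone hs
      have h2 := norm_kloosterman_le_card ZMod.stdAddChar A B
      rw [← K_eq_kloosterman, ZMod.card] at h2
      have h3 : (0 : ℝ) < (q : ℝ) ^ (n ^ 2) := by positivity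
      nlinarith [mul_le_mul_of_nonneg_left h1 h3.le, mul_pos hC h3]
    · have hle : (q : ℝ) / ℓ ≤ addOrderOf (A, B) := by
        have hdvd : q / addOrderOf (A, B) ∣ ℓ := hℓ ▸ div_dvd_gcdMat hr hA
        rw [div_le_iff₀ (by exact_mod_cast hℓ0)]
        have := Nat.mul_le_mul_left (addOrderOf (A, B)) (Nat.le_of_dvd hℓ0 hdvd)
        rw [Nat.mul_div_cancel' hr] at this
        exact_mod_cast this
      refine (hK q A B).trans ?_
      have := Real.rpow_le_rpow_of_nonpos (by linarith) hle hs
      gcongr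
      linarith
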